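/- Let $k$ be a field of characteristic zero and let $K\ge 3$ be an integer. For integers $M,N$ let \[ IT(M,N)=\mathrm{conv}\{(0,0),(M+N,KN),(M,0)\},\qquad RT(M,N)=\mathrm{conv}\{(0,0),(M,M+N),(M-\tfrac{M+N}{K},0)\}, \] and let $\tau(M,N)=(N,(K-1)N-(M+N))$. Let $\xi^{int}_{M,N}$ (respectively $\xi^{rat}_{M,N}$) denote the polynomial $f\in k[x,y]$ with constant term $1$, all of whose monomials $x^ay^b$ satisfy $(a,b)\in IT(M,N)$ (respectively $(a,b)\in RT(M,N)$), and which vanishes to order at least $M+N$ (respectively at least $M$) at the point $(1,1)$. Let $\varepsilon^{int}_{M,N}$ be the coefficient of $x^{M+N}y^{KN}$ in $\xi^{int}_{M,N}$, and $\varepsilon^{rat}_{M,N}$ the coefficient of $x^My^{M+N}$ in $\xi^{rat}_{M,N}$. Let $M,N\ge 0$ be integers with $(M+N)^2=KMN+1$. If $M>0$, then $\xi^{int}_{M,N}$, $\xi^{rat}_{M,N}$ and $\xi^{rat}_{\tau(M,N)}$ exist and are unique, and \[ \xi^{int}_{M,N}=\xi^{rat}_{M,N}\,\xi^{rat}_{\tau(M,N)}-\varepsilon^{rat}_{M,N}\,x^M(y-1)^{M+N}.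 \tag{1} \] If $N>0$, then $\xi^{int}_{M,N}$, $\xi^{int}_{\tau(M,N)}$ and $\xi^{rat}_{\tau(M,N)}$ exist and are unique, and \[ \big(\xi^{rat}_{\tau(M,N)}\big)^K=\xi^{int}_{M,N}\,\xi^{int}_{\tau(M,N)}-\varepsilon^{int}_{M,N}\,x^{M+N}(y-1)^{KN}. \tag{2} \] Moreover, given the coefficients $\varepsilon^{int}_{M,N}$ and $\varepsilon^{rat}_{M,N}$, these relations determine the polynomials with $M>N$ inductively: $\xi^{int}_{1,0}=1-x$ and $\xi^{rat}_{1,0}=1-xy$, and any two families of polynomials $F_{M,N},G_{M,N}\in k[x,y]$ with $F_{1,0}=1-x$, $G_{1,0}=1-xy$ that satisfy (1) and (2), with $F,G$ in place of $\xi^{int},\xi^{rat}$ and with the same coefficients $\varepsilon$, for all solutions $M>N>0$ of $(M+N)^2=KMN+1$, satisfy $F_{M,N}=\xi^{int}_{M,N}$ and $G_{M,N}=\xi^{rat}_{M,N}$ for all solutions $M>N\ge 0$. -/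

import Mathlib

open MvPolynomial

noncomputable section

/-- The integral triangle with vertices `(0,0)`, `(M+N, K N)`, `(M, 0)`, where `p = (M, N)`. -/
def IT (K : ℕ) (p : ℤ × ℤ) : Set (ℝ × ℝ) :=
  convexHull ℝ {((0 : ℝ), (0 : ℝ)), ((p.1 : ℝ) + p.2, (K : ℝ) * p.2), ((p.1 : ℝ), (0 : ℝ))}

/-- The rational triangle with vertices `(0,0)`, `(M, M+N)`, `(M - (M+N)/K, 0)`,
where `p = (M, N)`. -/
def RT (K : ℕ) (p : ℤ × ℤ) : Set (ℝ × ℝ) :=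
  convexHull ℝ {((0 : ℝ), (0 : ℝ)), ((p.1 : ℝ), (p.1 : ℝ) + p.2),
    ((p.1 : ℝ) - ((p.1 : ℝ) + p.2) / K, (0 : ℝ))}

/-- The transformation `τ(M,N) = (N, (K-1)N - (M+N))`. -/
def tau (K : ℕ) (p : ℤ × ℤ) : ℤ × ℤ :=
  (p.2, ((K : ℤ) - 1) * p.2 - (p.1 + p.2))

/-- The equation `(M+N)^2 = K M N + 1`. -/
def IsSolution (K M N : ℕ) : Prop := (M + N) ^ 2 = K * M * N + 1

variable {k : Type*} [Field k]

/-- Every monomial `x^a y^b` of `f` (with `x = X 0`, `y = X 1`) has `(a,b) ∈ Δ`; equivalently,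
the Newton polygon of `f` lies in the convex set `Δ`. -/
def SupportedIn (Δ : Set (ℝ × ℝ)) (f : MvPolynomial (Fin 2) k) : Prop :=
  ∀ d ∈ f.support, ((d 0 : ℝ), (d 1 : ℝ)) ∈ Δ

/-- `f` vanishes to order (at least) `m` at `e = (1,1)`: the Taylor expansion of `f` at `e`,
i.e. `f(x+1, y+1)`, has no terms of total degree less than `m`. -/
def VanishesToOrder (m : ℕ) (f : MvPolynomial (Fin 2) k) : Prop :=
  ∀ d : Fin 2 →₀ ℕ, d.degree < m → 
    coeff d (aeval (fun i => (X i + 1 : MvPolynomial (Fin 2) k)) f) = 0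

/-- `f` is supported in `Δ`, vanishes to order `m` at `e`, and has constant term `1`. -/
structure IsNormalizedCurve (Δ : Set (ℝ × ℝ)) (m : ℕ) (f : MvPolynomial (Fin 2) k) : Prop where
  supported : SupportedIn Δ f
  vanishes : VanishesToOrder m f
  constantTerm : coeff 0 f = 1

/-- `f` is a normalized polynomial of the curve of `IT(M,N)`, of vanishing order `M + N`. -/
def IsXiInt (K : ℕ) (p : ℤ × ℤ) (f : MvPolynomial (Fin 2) k) : Prop :=
  IsNormalizedCurve (IT K p) (p.1 + p.2).toNat f

/-- `f` is a normalized polynomial of the curve of `RT(M,N)`, of vanishing order `M`. -/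
def IsXiRat (K : ℕ) (p : ℤ × ℤ) (f : MvPolynomial (Fin 2) k) : Prop :=
  IsNormalizedCurve (RT K p) p.1.toNat f

variable (k)

/-- The polynomial `ξ^int_{M,N}`. -/
def xiInt (K : ℕ) (p : ℤ × ℤ) : MvPolynomial (Fin 2) k :=
  Classical.epsilon (IsXiInt K p)

/-- The polynomial `ξ^rat_{M,N}`. -/
def xiRat (K : ℕ) (p : ℤ × ℤ) : MvPolynomial (Fin 2) k :=
  Classical.epsilon (IsXiRat K p)

/-- `ε^int_{M,N}`: the coefficient in `ξ^int_{M,N}` of its highest degree monomial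
`x^(M+N) y^(K N)`, the top vertex of `IT(M,N)`. -/
def epsInt (K M N : ℕ) : k :=
  coeff (Finsupp.single 0 (M + N) + Finsupp.single 1 (K * N)) (xiInt k K (M, N))

/-- `ε^rat_{M,N}`: the coefficient in `ξ^rat_{M,N}` of its highest degree monomial
`x^M y^(M+N)`, the top vertex of `RT(M,N)`. -/
def epsRat (K M N : ℕ) : k :=
  coeff (Finsupp.single 0 M + Finsupp.single 1 (M + N)) (xiRat k K (M, N))

end

/-!
Applying products of the operators `x ∂/∂x - a` and `y ∂/∂y - b` to a polynomial that vanishes to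
order `m` at `(1,1)`, and evaluating there, isolates single coefficients. If the columns of a set of
exponents have sizes `1, …, m` in some order, this clears the columns from the smallest to the
largest, so that the `m (m + 1) / 2` conditions of vanishing to order `m` are independent on them.
Adding the exponent `(0,0)`, one gets exactly one normalized polynomial.

The triangles in question have their apex over the abscissa `m`, and their columns over `1, …, m`
have such sizes: they are strictly monotone on either side of the vertex on the first axis, and a
size on the left never equals one on the right, by an argument like that of Beatty's theorem,
because the self-intersection number of the curve is negative but only slightly so.

Every lattice point of the Minkowski sum of the two triangles on the right-hand side of a relation
lies in the triangle on the left-hand side, except for one apex. Subtracting the multiple of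
`x ^ a (y - 1) ^ s` that removes this monomial leaves a normalized polynomial of the triangle on the
left-hand side, and uniqueness gives the relation.
-/

section Vanishing

variable {k : Type*} [Field k]

/-- The substitution `f(x, y) ↦ f(x + 1, y + 1)`, which moves the point `(1,1)` to the origin. -/
noncomputable def recenter : MvPolynomial (Fin 2) k →ₐ[k] MvPolynomial (Fin 2) k :=
  aeval fun i => X i + 1

theorem vanishesToOrder_iff_recenter_mem {m : ℕ} {f : MvPolynomial (Fin 2) k} :
    VanishesToOrder m f ↔ recenter f ∈ idealOfVars (Fin 2) k ^ m :=
  (mem_pow_idealOfVars_iff' m _).symm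

namespace VanishesToOrder

variable {m n : ℕ} {f g : MvPolynomial (Fin 2) k}

theorem mono (hf : VanishesToOrder n f) (hmn : m ≤ n) : VanishesToOrder m f :=
  fun d hd => hf d (hd.trans_le hmn)

theorem sub (hf : VanishesToOrder m f) (hg : VanishesToOrder m g) :
    VanishesToOrder m (f - g) := by
  rw [vanishesToOrder_iff_recenter_mem] at hf hg ⊢
  simpa only [map_sub] using sub_mem hf hg

theorem mul (hf : VanishesToOrder m f) (hg : VanishesToOrder n g) :
    VanishesToOrder (m + n) (f * g) := by
  rw [vanishesToOrder_iff_recenter_mem] at hf hg ⊢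
  simpa only [map_mul, pow_add] using Ideal.mul_mem_mul hf hg

theorem mul_left (hf : VanishesToOrder m f) (g : MvPolynomial (Fin 2) k) :
    VanishesToOrder m (g * f) := by
  rw [vanishesToOrder_iff_recenter_mem] at hf ⊢
  simpa only [map_mul] using Ideal.mul_mem_left _ _ hf

theorem pow (hf : VanishesToOrder m f) (n : ℕ) : VanishesToOrder (n * m) (f ^ n) := by
  rw [vanishesToOrder_iff_recenter_mem] at hf ⊢
  simpa only [map_pow, mul_comm n, pow_mul] using Ideal.pow_mem_pow hf n

end VanishesToOrder

theorem vanishesToOrder_X_sub_one (i : Fin 2) :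
    VanishesToOrder 1 (X i - 1 : MvPolynomial (Fin 2) k) := by
  rw [vanishesToOrder_iff_recenter_mem, pow_one]
  simpa [recenter] using Ideal.subset_span (Set.mem_range_self i)

theorem VanishesToOrder.sum_coeff_eq_zero {f : MvPolynomial (Fin 2) k}
    (hf : VanishesToOrder 1 f) : ∑ d ∈ f.support, coeff d f = 0 := by
  rw [← hf 0 (by simp), ← constantCoeff_eq, aeval_def, eval₂_eq, map_sum]
  exact Finset.sum_congr rfl fun d _ => by simp [algebraMap_eq]

theorem pderiv_recenter (i : Fin 2) (f : MvPolynomial (Fin 2) k) :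
    pderiv i (recenter f) = recenter (pderiv i f) := by
  induction f using MvPolynomial.induction_on with
  | C a => simp [recenter, algebraMap_eq]
  | add p q hp hq => simp only [map_add, hp, hq]
  | mul_X p j hp =>
    rw [map_mul, Derivation.leibniz, Derivation.leibniz, hp]
    by_cases h : j = i
    · subst h; simp [recenter]
    · simp [recenter, pderiv_X_of_ne h]

theorem coeff_X_mul_pderiv {σ R : Type*} [CommSemiring R] (i : σ) (f : MvPolynomial σ R)
    (d : σ →₀ ℕ) :
    coeff d (X i * pderiv i f) = d i * coeff d f := by
  induction f using MvPolynomial.induction_on' with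
  | monomial e a =>
    classical
    rw [X_mul_pderiv_monomial, coeff_smul, coeff_monomial, nsmul_eq_mul]
    split_ifs with h
    · rw [h]
    · simp only [mul_zero]
  | add p q hp hq => simp only [map_add, mul_add, coeff_add, hp, hq]

theorem VanishesToOrder.X_mul_pderiv {m : ℕ} {f : MvPolynomial (Fin 2) k}
    (hf : VanishesToOrder (m + 1) f) (i : Fin 2) : VanishesToOrder m (X i * pderiv i f) := by
  refine VanishesToOrder.mul_left (fun d hd => ?_) _
  have hd' : (d + Finsupp.single i 1).degree < m + 1 := by
    rw [map_add, Finsupp.degree_single]; omega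
  rw [← recenter, ← pderiv_recenter, coeff_pderiv, recenter, hf _ hd', zero_mul]

theorem VanishesToOrder.exists_coeff_eq_pow_mul {f : MvPolynomial (Fin 2) k} {m : ℕ} (i : Fin 2)
    (n : ℕ) (hf : VanishesToOrder (m + n) f) :
    ∃ g : MvPolynomial (Fin 2) k, VanishesToOrder m g ∧
      ∀ d, coeff d g = (d i : k) ^ n * coeff d f := by
  induction n generalizing f with
  | zero => exact ⟨f, hf, by simp⟩
  | succ n ih =>
    obtain ⟨g, hg, hgf⟩ := ih (hf.X_mul_pderiv i)
    exact ⟨g, hg, fun d => by rw [hgf, coeff_X_mul_pderiv]; ring⟩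

theorem VanishesToOrder.sum_eval_mul_coeff_eq_zero {m : ℕ} {f P : MvPolynomial (Fin 2) k}
    (hf : VanishesToOrder m f) (hP : P.totalDegree < m) :
    ∑ d ∈ f.support, eval (fun i => (d i : k)) P * coeff d f = 0 := by
  suffices h : ∀ e ∈ P.support, ∑ d ∈ f.support, (∏ i, (d i : k) ^ e i) * coeff d f = 0 by
    simp only [eval_eq', Finset.sum_mul]
    rw [Finset.sum_comm]
    refine Finset.sum_eq_zero fun e he => ?_
    simp only [mul_assoc, ← Finset.mul_sum, h e he, mul_zero]
  intro e he
  have hem : 1 + e 1 + e 0 ≤ m := by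
    have := le_totalDegree he
    rw [Finsupp.sum_fintype _ _ fun _ => rfl, Fin.sum_univ_two] at this
    omega
  obtain ⟨g, hg, hgf⟩ := (hf.mono hem).exists_coeff_eq_pow_mul 0
  obtain ⟨h, hh, hhg⟩ := hg.exists_coeff_eq_pow_mul 1
  have hsub : h.support ⊆ f.support := fun d hd => by
    rw [mem_support_iff, hhg, hgf] at hd
    exact mem_support_iff.mpr (right_ne_zero_of_mul (right_ne_zero_of_mul hd))
  rw [← hh.sum_coeff_eq_zero, Finset.sum_subset hsub fun d _ => notMem_support_iff.mp]
  refine Finset.sum_congr rfl fun d _ => ?_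
  rw [hhg, hgf, Fin.prod_univ_two]
  ring

theorem totalDegree_prod_X_sub_C_le {σ ι R : Type*} [CommRing R] [Nontrivial R] (i : σ)
    (s : Finset ι) (c : ι → R) :
    (∏ j ∈ s, (X i - C (c j)) : MvPolynomial σ R).totalDegree ≤ s.card := by
  refine (totalDegree_finsetProd s _).trans ?_
  rw [Finset.card_eq_sum_ones]
  exact Finset.sum_le_sum fun j _ => (totalDegree_sub_C_le _ _).trans (totalDegree_X i).le

theorem VanishesToOrder.coeff_eq_zero [CharZero k] {m : ℕ} {f : MvPolynomial (Fin 2) k}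
    (hf : VanishesToOrder m f) {A B : Finset ℕ} {d : Fin 2 →₀ ℕ} (hdA : d 0 ∈ A) (hdB : d 1 ∈ B)
    (hA : ∀ e ∈ f.support, e 0 ∈ A) (hB : ∀ e ∈ f.support, e 0 = d 0 → e 1 ∈ B)
    (hcard : A.card + B.card ≤ m + 1) : coeff d f = 0 := by
  -- A product of linear forms that cuts out `d` among the exponents of `f`.
  set P : MvPolynomial (Fin 2) k :=
    (∏ a ∈ A.erase (d 0), (X 0 - C (a : k))) * ∏ b ∈ B.erase (d 1), (X 1 - C (b : k)) with hP
  have hPdeg : P.totalDegree < m := by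
    have hmul : P.totalDegree ≤ _ := totalDegree_mul _ _
    have := totalDegree_prod_X_sub_C_le (0 : Fin 2) (A.erase (d 0)) fun a => (a : k)
    have := totalDegree_prod_X_sub_C_le (1 : Fin 2) (B.erase (d 1)) fun b => (b : k)
    have := Finset.card_erase_add_one hdA
    have := Finset.card_erase_add_one hdB
    omega
  have hPeval (e : Fin 2 →₀ ℕ) : eval (fun i => (e i : k)) P =
      (∏ a ∈ A.erase (d 0), ((e 0 : k) - a)) * ∏ b ∈ B.erase (d 1), ((e 1 : k) - b) := by
    simp [hP, map_prod]
  have hPd : eval (fun i => (d i : k)) P ≠ 0 := by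
    simp only [hPeval, mul_ne_zero_iff, Finset.prod_ne_zero_iff, sub_ne_zero, Ne, Nat.cast_inj]
    exact ⟨fun a ha => (Finset.ne_of_mem_erase ha).symm,
      fun b hb => (Finset.ne_of_mem_erase hb).symm⟩
  have hPe : ∀ e ∈ f.support, e ≠ d → eval (fun i => (e i : k)) P * coeff e f = 0 := by
    intro e he hed
    rw [hPeval]
    by_cases h0 : e 0 = d 0
    · have h1 : e 1 ≠ d 1 := fun h1 => hed (Finsupp.ext (Fin.forall_fin_two.mpr ⟨h0, h1⟩))
      rw [Finset.prod_eq_zero (Finset.mem_erase.mpr ⟨h1, hB e he h0⟩) (sub_self _)]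
      simp only [mul_zero, zero_mul]
    · rw [Finset.prod_eq_zero (Finset.mem_erase.mpr ⟨h0, hA e he⟩) (sub_self _)]
      simp only [zero_mul]
  have hsum := hf.sum_eval_mul_coeff_eq_zero hPdeg
  rw [Finset.sum_eq_single d hPe fun h => by rw [notMem_support_iff.mp h, mul_zero]] at hsum
  exact (mul_eq_zero.mp hsum).resolve_left hPd

theorem eq_zero_of_columns [CharZero k] {m : ℕ} {A : Finset ℕ} {B : ℕ → Finset ℕ}
    (hle : ∀ a ∈ A, (B a).card ≤ m) (hinj : Set.InjOn (fun a => (B a).card) A)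
    {f : MvPolynomial (Fin 2) k} (hf : VanishesToOrder m f)
    (hsupp : ∀ d ∈ f.support, d 0 ∈ A ∧ d 1 ∈ B (d 0)) : f = 0 := by
  -- The columns of size `v` are cleared one after the other: at most `m - v` larger ones remain.
  have hlarge : ∀ v, ∀ d ∈ f.support, v < (B (d 0)).card := by
    intro v
    induction v with
    | zero => exact fun d hd => Finset.card_pos.mpr ⟨_, (hsupp d hd).2⟩
    | succ v ih =>
      intro d hd
      by_contra hlt
      have hv : (B (d 0)).card = v + 1 := le_antisymm (not_lt.mp hlt) (ih d hd)
      have hcolumns : (A.filter fun a => v < (B a).card).card ≤ (Finset.Icc (v + 1) m).card :=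
        Finset.card_le_card_of_injOn (fun a => (B a).card)
          (fun a ha => by
            obtain ⟨haA, hva⟩ := Finset.mem_filter.mp ha
            exact Finset.mem_coe.mpr (Finset.mem_Icc.mpr ⟨hva, hle a haA⟩))
          (hinj.mono (Finset.coe_subset.mpr (Finset.filter_subset _ _)))
      refine mem_support_iff.mp hd (hf.coeff_eq_zero (A := A.filter fun a => v < (B a).card)
        (Finset.mem_filter.mpr ⟨(hsupp d hd).1, ih d hd⟩) (hsupp d hd).2
        (fun e he => Finset.mem_filter.mpr ⟨(hsupp e he).1, ih e he⟩)
        (fun e he h => h ▸ (hsupp e he).2) ?_)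
      have hvm := hle _ (hsupp d hd).1
      rw [Nat.card_Icc] at hcolumns
      omega
  by_contra hne
  obtain ⟨d, hd⟩ := support_nonempty.mpr hne
  exact (hlarge m d hd).not_ge (hle _ (hsupp d hd).1)

theorem card_biUnion_finsuppAntidiag (m : ℕ) :
    ((Finset.range m).biUnion (Finset.finsuppAntidiag (Finset.univ : Finset (Fin 2)))).card
      = ∑ n ∈ Finset.range m, (n + 1) := by
  rw [Finset.card_biUnion]
  · simp [Finset.card_finsuppAntidiag_nat_eq_choose, Nat.add_comm 1, Nat.choose_succ_self_right]
  · intro i _ j _ hij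
    refine Finset.disjoint_left.mpr fun d hi hj => hij ?_
    rw [← (Finset.mem_finsuppAntidiag.mp hi).1, (Finset.mem_finsuppAntidiag.mp hj).1]

theorem exists_vanishesToOrder_add {m : ℕ} {S : Finset (Fin 2 →₀ ℕ)}
    (hcard : S.card = ∑ n ∈ Finset.range m, (n + 1))
    (hS : ∀ g : MvPolynomial (Fin 2) k, g.support ⊆ S → VanishesToOrder m g → g = 0)
    (f : MvPolynomial (Fin 2) k) :
    ∃ g : MvPolynomial (Fin 2) k, g.support ⊆ S ∧ VanishesToOrder m (f + g) := by
  set D := (Finset.range m).biUnion (Finset.finsuppAntidiag (Finset.univ : Finset (Fin 2)))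
  have hD {d : Fin 2 →₀ ℕ} : d ∈ D ↔ d.degree < m := by
    simp [D, Finsupp.degree_eq_sum]
  let taylor : MvPolynomial (Fin 2) k →ₗ[k] D → k :=
    LinearMap.pi fun d => lcoeff k d ∘ₗ recenter.toLinearMap
  have htaylor {g : MvPolynomial (Fin 2) k} : taylor g = 0 ↔ VanishesToOrder m g := by
    simp only [funext_iff, Subtype.forall, hD]
    rfl
  set V := restrictSupport k (S : Set (Fin 2 →₀ ℕ))
  have hsupp (g : V) : g.1.support ⊆ S :=
    Finset.coe_subset.mp ((mem_restrictSupport_iff k).mp g.2)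
  have hinj : Function.Injective (taylor.domRestrict V) := by
    rw [injective_iff_map_eq_zero]
    intro g hg
    exact Subtype.ext (hS g (hsupp g) (htaylor.mp hg))
  have hsurj : Function.Surjective (taylor.domRestrict V) := by
    have basis := basisRestrictSupport k (S : Set (Fin 2 →₀ ℕ))
    have := Module.Finite.of_basis basis
    refine (LinearMap.injective_iff_surjective_of_finrank_eq_finrank ?_).mp hinj
    rw [Module.finrank_eq_card_basis basis, Module.finrank_fintype_fun_eq_card, Fintype.card_coe,
      card_biUnion_finsuppAntidiag, ← hcard]
    exact Fintype.card_coe S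
  obtain ⟨g, hg⟩ := hsurj (-taylor f)
  refine ⟨g, hsupp g, htaylor.mp ?_⟩
  rw [map_add, show taylor g = -taylor f from hg, add_neg_cancel]

/-- The exponents `(a, b)` with `a ∈ A` and `b ∈ B a`. -/
noncomputable def columnSet (A : Finset ℕ) (B : ℕ → Finset ℕ) : Finset (Fin 2 →₀ ℕ) :=
  (A.sigma B).map ((Equiv.sigmaEquivProd ℕ ℕ).trans
    ((finTwoArrowEquiv ℕ).symm.trans Finsupp.equivFunOnFinite.symm)).toEmbedding

theorem mem_columnSet {A : Finset ℕ} {B : ℕ → Finset ℕ} {d : Fin 2 →₀ ℕ} :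
    d ∈ columnSet A B ↔ d 0 ∈ A ∧ d 1 ∈ B (d 0) := by
  rw [columnSet, Finset.mem_map_equiv]
  exact Finset.mem_sigma

theorem card_columnSet (A : Finset ℕ) (B : ℕ → Finset ℕ) :
    (columnSet A B).card = ∑ a ∈ A, (B a).card := by
  rw [columnSet, Finset.card_map, Finset.card_sigma]

theorem existsUnique_of_columns [CharZero k] {m : ℕ} {A : Finset ℕ} {B : ℕ → Finset ℕ}
    (hA : 0 ∉ A) (hB : Set.BijOn (fun a => (B a).card) A (Finset.Icc 1 m)) :
    ∃! f : MvPolynomial (Fin 2) k, f.support ⊆ insert 0 (columnSet A B) ∧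
      VanishesToOrder m f ∧ coeff 0 f = 1 := by
  have hzero (g : MvPolynomial (Fin 2) k) (hg : g.support ⊆ columnSet A B)
      (hm : VanishesToOrder m g) : g = 0 :=
    eq_zero_of_columns (fun a ha => (Finset.mem_Icc.mp (hB.mapsTo ha)).2) hB.injOn hm
      fun d hd => mem_columnSet.mp (hg hd)
  have hcard : (columnSet A B).card = ∑ n ∈ Finset.range m, (n + 1) := by
    rw [card_columnSet, Finset.range_eq_Ico, Finset.sum_Ico_add' (fun n => n) 0 m 1, zero_add,
      Finset.Ico_add_one_right_eq_Icc]
    exact Finset.sum_nbij _ hB.mapsTo hB.injOn hB.surjOn fun _ _ => rfl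
  have h0 : (0 : Fin 2 →₀ ℕ) ∉ columnSet A B := fun h => hA (mem_columnSet.mp h).1
  obtain ⟨g, hg, hfg⟩ := exists_vanishesToOrder_add hcard hzero 1
  have hsupp : (1 + g).support ⊆ insert 0 (columnSet A B) :=
    support_add.trans (Finset.union_subset (support_monomial_subset.trans (by simp))
      (hg.trans (Finset.subset_insert _ _)))
  have hconst : coeff 0 (1 + g) = 1 := by
    rw [coeff_add, coeff_zero_one, notMem_support_iff.mp fun h => h0 (hg h), add_zero]
  refine ⟨1 + g, ⟨hsupp, hfg, hconst⟩, fun f ⟨hf, hfm, hf0⟩ => ?_⟩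
  refine sub_eq_zero.mp (hzero _ ?_ (hfm.sub hfg))
  have hnot : 0 ∉ (f - (1 + g)).support := by
    rw [notMem_support_iff, coeff_sub, hf0, hconst, sub_self]
  rw [← Finset.subset_insert_iff_of_notMem hnot]
  exact (support_sub _ _ _).trans (Finset.union_subset hf hsupp)

end Vanishing

section Triangle

open scoped Pointwise

/-- The triangle with vertices `(0, 0)`, `(m, s)` and `(m - s / K, 0)`: a triangle with apex
`(m, s)` whose base lies on the first axis and whose right side has slope `K`. -/
def triangle (K m s : ℝ) : Set (ℝ × ℝ) :=
  convexHull ℝ {(0, 0), (m, s), (m - s / K, 0)}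

theorem smul_triangle (c K m s : ℝ) : c • triangle K m s = triangle K (c * m) (c * s) := by
  simp [triangle, ← convexHull_smul, Set.smul_set_insert, mul_sub, mul_div_assoc]

theorem smul_add_smul_mem_convexHull {E : Type*} [AddCommGroup E] [Module ℝ E] {u v : ℝ}
    (hu : 0 ≤ u) (hv : 0 ≤ v) (huv : u + v ≤ 1) (P Q : E) :
    u • P + v • Q ∈ convexHull ℝ {0, P, Q} := by
  have h := (convex_convexHull ℝ {0, P, Q}).sum_mem (t := Finset.univ) (w := ![1 - u - v, u, v])
    (z := ![0, P, Q]) (by simp [Fin.forall_fin_succ, hu, hv]; linarith)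
    (by simp [Fin.sum_univ_three]; ring)
    fun i _ => subset_convexHull ℝ _ (by fin_cases i <;> simp)
  simpa [Fin.sum_univ_three] using h

theorem mem_triangle_of_le {K m s x y : ℝ} (hK : 0 < K) (hm : 0 < m) (hs : 0 ≤ s)
    (hsm : s ≤ K * m) (hx : 0 ≤ x) (hxm : x ≤ m) (hy : 0 ≤ y) (hyx : m * y ≤ s * x)
    (hxy : K * x + s ≤ K * m + y) : (x, y) ∈ triangle K m s := by
  set u := y / s
  set w := m - s / K
  have hw : 0 ≤ w := sub_nonneg.mpr ((div_le_iff₀' hK).mpr hsm)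
  set v := (x - u * m) / w
  have hus : u * s = y := div_mul_cancel_of_imp (by rintro rfl; nlinarith)
  have hu : 0 ≤ u := div_nonneg hy hs
  have hu1 : u ≤ 1 := div_le_one_of_le₀ (by nlinarith) hs
  have hum : u * m ≤ x := by
    rw [div_mul_eq_mul_div, mul_comm y]
    exact div_le_of_le_mul₀ hs hx (by rwa [mul_comm x])
  have hwx : x - u * m ≤ (1 - u) * w := by
    have hKw : K * w = K * m - s := by simp only [w]; field_simp
    refine le_of_mul_le_mul_left ?_ hK
    linear_combination hxy - (1 - u) * hKw - hus
  have hvw : v * w = x - u * m := div_mul_cancel_of_imp fun h => by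
    rw [h, mul_zero] at hwx; linarith
  have hv : v ≤ 1 - u := div_le_of_le_mul₀ hw (by linarith) hwx
  have heq : (x, y) = u • (m, s) + v • (w, 0) := by
    ext
    · simp only [Prod.fst_add, Prod.smul_fst, smul_eq_mul, hvw, add_sub_cancel]
    · simp only [Prod.snd_add, Prod.smul_snd, smul_eq_mul, hus, mul_zero, add_zero]
  rw [heq]
  exact smul_add_smul_mem_convexHull hu (div_nonneg (sub_nonneg.mpr hum) hw) (by linarith) _ _

theorem mem_triangle_iff {K m s x y : ℝ} (hK : 0 < K) (hm : 0 < m) (hs : 0 ≤ s)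
    (hsm : s ≤ K * m) :
    (x, y) ∈ triangle K m s ↔
      0 ≤ x ∧ x ≤ m ∧ 0 ≤ y ∧ m * y ≤ s * x ∧ K * x + s ≤ K * m + y := by
  refine ⟨?_, fun ⟨hx, hxm, hy, hyx, hxy⟩ => mem_triangle_of_le hK hm hs hsm hx hxm hy hyx hxy⟩
  suffices h : triangle K m s ⊆ {p | 0 ≤ p.1 ∧ p.1 ≤ m ∧ 0 ≤ p.2 ∧ m * p.2 ≤ s * p.1 ∧
      K * p.1 + s ≤ K * m + p.2} from fun hp => h hp
  refine convexHull_min ?_ ?_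
  · have hw : 0 ≤ m - s / K := sub_nonneg.mpr ((div_le_iff₀' hK).mpr hsm)
    have hsK : K * (m - s / K) = K * m - s := by field_simp
    rintro p (rfl | rfl | rfl)
    · simpa using ⟨hm.le, hsm⟩
    · simpa using ⟨hm.le, hs, (mul_comm m s).le⟩
    · simpa [hsK] using ⟨sub_nonneg.mp hw, div_nonneg hs hK.le, mul_nonneg hs hw⟩
  · rintro p ⟨hp₁, hp₂, hp₃, hp₄, hp₅⟩ q ⟨hq₁, hq₂, hq₃, hq₄, hq₅⟩ a b ha hb hab
    obtain rfl : b = 1 - a := by linarith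
    simp only [Set.mem_ofPred_eq, Prod.fst_add, Prod.snd_add, Prod.smul_fst, Prod.smul_snd,
      smul_eq_mul]
    refine ⟨by positivity, ?_, by positivity, ?_, ?_⟩
    · linear_combination a * hp₂ + (1 - a) * hq₂
    · linear_combination a * hp₄ + (1 - a) * hq₄
    · linear_combination a * hp₅ + (1 - a) * hq₅

theorem natCast_mem_triangle_iff {K m s t a b : ℕ} (hK : 0 < K) (hm : 0 < m)
    (hst : s + t = K * m) :
    ((a : ℝ), (b : ℝ)) ∈ triangle K m s ↔ a ≤ m ∧ m * b ≤ s * a ∧ K * a ≤ t + b := by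
  have hsm : (s : ℝ) ≤ K * m := by exact_mod_cast hst.le.trans' (Nat.le_add_right s t)
  rw [mem_triangle_iff (by exact_mod_cast hK) (by exact_mod_cast hm) s.cast_nonneg hsm]
  norm_cast
  simp only [Nat.zero_le, true_and]
  refine and_congr_right' (and_congr_right' ?_)
  omega

end Triangle

section Balanced

/-- For `s + t = K m`, the self-intersection number `s t / K - m ^ 2` of the curve of
`triangle K m s` on the blowup at `(1,1)` is negative and at least `-1 / c`. -/
structure IsBalanced (K c m s t : ℕ) : Prop where
  add_eq : s + t = K * m
  mul_lt : s * t < K * m ^ 2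
  le_mul : c * (K * m ^ 2) ≤ c * (s * t) + K

/-- The heights of the lattice points of `triangle K (c * m) (c * s)` over the abscissa `a`, where
`s + t = K m`. -/
def triangleColumn (K c m s t a : ℕ) : Finset ℕ :=
  Finset.Icc (K * a - c * t) (s * a / m)

theorem card_triangleColumn_of_le {K c m s t a : ℕ} (ha : K * a ≤ c * t) :
    (triangleColumn K c m s t a).card = s * a / m + 1 := by
  rw [triangleColumn, Nat.card_Icc, Nat.sub_eq_zero_of_le ha, Nat.sub_zero]

theorem card_triangleColumn_of_ge {K c m s t a : ℕ} (hm : 0 < m) (hst : s + t = K * m)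
    (hac : a ≤ c * m) (ha : c * t ≤ K * a) :
    (triangleColumn K c m s t a).card = t * (c * m - a) / m + 1 := by
  obtain ⟨e, he⟩ := Nat.exists_eq_add_of_le ha
  obtain ⟨j, hj⟩ := Nat.exists_eq_add_of_le hac
  have hdiv : s * a = t * j + m * e := by
    zify at *
    linear_combination a * hst + m * he + t * hj
  rw [triangleColumn, Nat.card_Icc, he, hj, Nat.add_sub_cancel_left, Nat.add_sub_cancel_left, hdiv,
    Nat.add_mul_div_left _ _ hm, Nat.add_right_comm, Nat.add_sub_cancel]

namespace IsBalanced

variable {K c m s t : ℕ}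

theorem symm (h : IsBalanced K c m s t) : IsBalanced K c m t s where
  add_eq := by rw [add_comm, h.add_eq]
  mul_lt := mul_comm s t ▸ h.mul_lt
  le_mul := mul_comm s t ▸ h.le_mul

theorem pos (h : IsBalanced K c m s t) : 0 < K * m := by
  have := h.mul_lt.trans_le' (Nat.zero_le _)
  exact Nat.pos_of_ne_zero fun h0 => by simp [sq, ← mul_assoc, h0] at this

theorem le_or_mul_le_one (h : IsBalanced K c m s t) : m ≤ s ∨ c * m ≤ 1 := by
  by_contra! hlt
  have hdefect : K * m ^ 2 = s * t + s ^ 2 + K * m * (m - s) := by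
    have := h.add_eq
    zify [hlt.1.le] at *
    linear_combination -s * this
  have hKm : c * (K * m) ≤ K := by
    have := h.le_mul
    have : K * m ≤ K * m * (m - s) := Nat.le_mul_of_pos_right _ (Nat.sub_pos_of_lt hlt.1)
    nlinarith
  nlinarith [hlt.2, Nat.pos_of_mul_pos_right h.pos]

theorem div_lt_div (h : IsBalanced K c m s t) (hcm : 1 < c * m) {x y : ℕ}
    (hxy : x < y) : s * x / m < s * y / m := by
  have hm : 0 < m := Nat.pos_of_mul_pos_left h.pos
  have hms : m ≤ s := h.le_or_mul_le_one.resolve_right hcm.not_ge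
  rw [← Nat.succ_le_iff, Nat.succ_eq_add_one, ← Nat.add_div_right _ hm]
  exact Nat.div_le_div_right (by nlinarith)

theorem div_lt (h : IsBalanced K c m s t) (hc : 0 < c) {x : ℕ} (hx : K * x ≤ c * t) :
    s * x / m < c * m := by
  have hm := Nat.pos_of_mul_pos_left h.pos
  rw [Nat.div_lt_iff_lt_mul hm]
  refine Nat.lt_of_mul_lt_mul_left (a := K) ?_
  calc K * (s * x) = s * (K * x) := by ring
    _ ≤ s * (c * t) := Nat.mul_le_mul_left s hx
    _ = c * (s * t) := by ring
    _ < c * (K * m ^ 2) := Nat.mul_lt_mul_of_pos_left h.mul_lt hc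
    _ = K * (c * m * m) := by ring

/-- A form of Beatty's theorem: the reciprocals of the slopes `s / m` and `t / m` add up to
slightly more than `1`. -/
theorem div_ne_div (h : IsBalanced K c m s t) {x y : ℕ} (hx : 0 < x) (hxy : x + y < c * m) :
    s * x / m ≠ t * y / m := by
  have hm := Nat.pos_of_mul_pos_left h.pos
  have hst := h.add_eq
  intro heq
  set v := s * x / m
  have hsum : s * t * (x + y) = t * (s * x) + s * (t * y) := by ring
  have hlow : v < x + y := by
    have hsx : v * m ≤ s * x := Nat.div_mul_le_self _ _
    have hty : v * m ≤ t * y := heq ▸ Nat.div_mul_le_self _ _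
    refine Nat.lt_of_mul_lt_mul_left (a := K * m ^ 2) ?_
    calc K * m ^ 2 * v = (K * m) * (v * m) := by ring
      _ = t * (v * m) + s * (v * m) := by rw [← hst]; ring
      _ ≤ s * t * (x + y) := hsum ▸ by gcongr
      _ < K * m ^ 2 * (x + y) := Nat.mul_lt_mul_of_pos_right h.mul_lt (by omega)
  have hhigh : x + y < v + 1 := by
    have hsx : s * x + 1 ≤ m * (v + 1) := Nat.lt_mul_div_succ _ hm
    have hty : t * y + 1 ≤ m * (v + 1) := heq ▸ Nat.lt_mul_div_succ _ hm
    have hdefect : K * m ^ 2 * (x + y) < s * t * (x + y) + K * m := by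
      refine Nat.lt_of_mul_lt_mul_left (a := c) ?_
      calc c * (K * m ^ 2 * (x + y)) = c * (K * m ^ 2) * (x + y) := by ring
        _ ≤ (c * (s * t) + K) * (x + y) := Nat.mul_le_mul_right _ h.le_mul
        _ = c * (s * t * (x + y)) + K * (x + y) := by ring
        _ < c * (s * t * (x + y)) + K * (c * m) := by
          gcongr; exact Nat.pos_of_mul_pos_right h.pos
        _ = c * (s * t * (x + y) + K * m) := by ring
    refine Nat.lt_of_mul_lt_mul_left (a := K * m ^ 2) (hdefect.trans_le ?_)
    calc s * t * (x + y) + K * m = t * (s * x + 1) + s * (t * y + 1) := by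
          rw [hsum, ← hst]; ring
      _ ≤ t * (m * (v + 1)) + s * (m * (v + 1)) := by gcongr
      _ = K * m ^ 2 * (v + 1) := by linear_combination (m * (v + 1)) * hst
  omega

end IsBalanced

theorem IsBalanced.card_triangleColumn_mem {K c m s t a : ℕ} (h : IsBalanced K c m s t)
    (hc : 0 < c) (ha : a ≤ c * m) :
    (triangleColumn K c m s t a).card ∈ Finset.Icc 1 (c * m) := by
  rw [Finset.mem_Icc]
  rcases le_total (K * a) (c * t) with hat | hat
  · rw [card_triangleColumn_of_le hat]
    exact ⟨Nat.le_add_left _ _, h.div_lt hc hat⟩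
  · have hcs : K * (c * m - a) ≤ c * s := by
      have : K * (c * m) = c * s + c * t := by rw [← mul_add, h.add_eq]; ring
      rw [Nat.mul_sub]
      omega
    rw [card_triangleColumn_of_ge (Nat.pos_of_mul_pos_left h.pos) h.add_eq ha hat]
    exact ⟨Nat.le_add_left _ _, h.symm.div_lt hc hcs⟩

theorem IsBalanced.card_triangleColumn_ne {K c m s t a b : ℕ} (h : IsBalanced K c m s t)
    (ha : 0 < a) (hab : a < b) (hb : b ≤ c * m) :
    (triangleColumn K c m s t a).card ≠ (triangleColumn K c m s t b).card := by
  have hcm : 1 < c * m := by omega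
  have hm := Nat.pos_of_mul_pos_left h.pos
  have hKab : K * a ≤ K * b := Nat.mul_le_mul_left K hab.le
  rcases le_total (K * b) (c * t) with hbt | hbt
  · rw [card_triangleColumn_of_le hbt, card_triangleColumn_of_le (hKab.trans hbt)]
    exact (Nat.succ_lt_succ (h.div_lt_div hcm hab)).ne
  rw [card_triangleColumn_of_ge hm h.add_eq hb hbt]
  rcases le_total (K * a) (c * t) with hat | hat
  · rw [card_triangleColumn_of_le hat]
    exact fun heq => h.div_ne_div ha (by omega) (Nat.succ_injective heq)
  · rw [card_triangleColumn_of_ge hm h.add_eq (hab.le.trans hb) hat]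
    exact (Nat.succ_lt_succ (h.symm.div_lt_div hcm (by omega))).ne'

theorem IsBalanced.bijOn_card_triangleColumn {K c m s t : ℕ} (h : IsBalanced K c m s t)
    (hc : 0 < c) :
    Set.BijOn (fun a => (triangleColumn K c m s t a).card) (Finset.Icc 1 (c * m))
      (Finset.Icc 1 (c * m)) := by
  have hmaps : Set.MapsTo (fun a => (triangleColumn K c m s t a).card) (Finset.Icc 1 (c * m))
      (Finset.Icc 1 (c * m)) := fun a ha =>
    h.card_triangleColumn_mem hc (Finset.mem_Icc.mp ha).2
  have hinj : Set.InjOn (fun a => (triangleColumn K c m s t a).card) (Finset.Icc 1 (c * m)) := by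
    simp only [Set.InjOn, Finset.mem_coe, Finset.mem_Icc]
    intro a ha b hb heq
    rcases lt_trichotomy a b with hab | hab | hab
    · exact absurd heq (h.card_triangleColumn_ne ha.1 hab hb.2)
    · exact hab
    · exact absurd heq.symm (h.card_triangleColumn_ne hb.1 hab ha.2)
  exact ⟨hmaps, hinj, Finset.surjOn_of_injOn_of_card_le _ hmaps hinj le_rfl⟩

variable {k : Type*} [Field k]

theorem IsBalanced.supportedIn_iff {K c m s t : ℕ} (h : IsBalanced K c m s t) (hc : 0 < c)
    {f : MvPolynomial (Fin 2) k} :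
    SupportedIn (triangle K (c * m) (c * s)) f ↔
      f.support ⊆ insert 0 (columnSet (Finset.Icc 1 (c * m)) (triangleColumn K c m s t)) := by
  have hm := Nat.pos_of_mul_pos_left h.pos
  have hK := Nat.pos_of_mul_pos_right h.pos
  refine forall₂_congr fun d _ => ?_
  have hst : c * s + c * t = K * (c * m) := by rw [← mul_add, h.add_eq]; ring
  have hmem := natCast_mem_triangle_iff (a := d 0) (b := d 1) hK (Nat.mul_pos hc hm) hst
  push_cast at hmem
  have hzero : d = 0 ↔ d 0 = 0 ∧ d 1 = 0 := by
    rw [Finsupp.ext_iff, Fin.forall_fin_two]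
    rfl
  rw [hmem, Finset.mem_insert, mem_columnSet, Finset.mem_Icc, triangleColumn, Finset.mem_Icc,
    Nat.le_div_iff_mul_le hm, mul_comm (d 1), tsub_le_iff_left, mul_assoc, mul_assoc,
    Nat.mul_le_mul_left_iff hc, hzero]
  rcases Nat.eq_zero_or_pos (d 0) with h0 | h0
  · simp [h0, hm.ne']
  · simp only [h0.ne', Nat.succ_le_iff, h0, false_and, false_or, true_and, and_comm]

theorem IsBalanced.existsUnique_isNormalizedCurve [CharZero k] {K c m s t : ℕ}
    (h : IsBalanced K c m s t) (hc : 0 < c) :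
    ∃! f : MvPolynomial (Fin 2) k,
      IsNormalizedCurve (triangle K (c * m) (c * s)) (c * m) f := by
  refine (existsUnique_congr fun f => ?_).mp
    (existsUnique_of_columns (by simp) (h.bijOn_card_triangleColumn hc))
  rw [← h.supportedIn_iff hc]
  exact ⟨fun ⟨hs, hv, h0⟩ => ⟨hs, hv, h0⟩, fun ⟨hs, hv, h0⟩ => ⟨hs, hv, h0⟩⟩

end Balanced

section Curves

open scoped Pointwise

variable {k : Type*} [Field k] {Δ Δ₁ Δ₂ : Set (ℝ × ℝ)} {f g : MvPolynomial (Fin 2) k}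

theorem SupportedIn.mul (hf : SupportedIn Δ₁ f) (hg : SupportedIn Δ₂ g) :
    SupportedIn (Δ₁ + Δ₂) (f * g) := by
  intro d hd
  obtain ⟨u, hu, v, hv, rfl⟩ := Finset.mem_add.mp (support_mul _ _ hd)
  exact Set.mem_add.mpr ⟨_, hf u hu, _, hg v hv, by simp⟩

namespace IsNormalizedCurve

variable {m n : ℕ}

theorem ne_zero (hf : IsNormalizedCurve Δ m f) : f ≠ 0 := by
  rintro rfl
  simpa using hf.constantTerm

theorem mul (hf : IsNormalizedCurve Δ₁ m f) (hg : IsNormalizedCurve Δ₂ n g) :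
    IsNormalizedCurve (Δ₁ + Δ₂) (m + n) (f * g) where
  supported := hf.supported.mul hg.supported
  vanishes := hf.vanishes.mul hg.vanishes
  constantTerm := by
    have hf0 := hf.constantTerm
    have hg0 := hg.constantTerm
    rw [← constantCoeff_eq] at *
    rw [map_mul, hf0, hg0, one_mul]

theorem pow (hf : IsNormalizedCurve Δ m f) (hΔ : Convex ℝ Δ) (n : ℕ) :
    IsNormalizedCurve ((n : ℝ) • Δ) (n * m) (f ^ n) := by
  have hzero : (0 : ℝ × ℝ) ∈ Δ := by
    have h := hf.supported 0 (by simp [mem_support_iff, hf.constantTerm])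
    simp only [Finsupp.coe_zero, Pi.zero_apply, Nat.cast_zero] at h
    exact h
  induction n with
  | zero =>
    rw [Nat.cast_zero, Set.zero_smul_set ⟨0, hzero⟩, zero_mul, pow_zero]
    refine ⟨fun d hd => ?_, fun d hd => absurd hd (Nat.not_lt_zero _), coeff_zero_one⟩
    have hd0 : d = 0 := by simpa using hd
    simp [hd0]
  | succ n ih =>
    rw [Nat.cast_succ, hΔ.add_smul n.cast_nonneg zero_le_one, one_smul, Nat.succ_mul, pow_succ]
    exact ih.mul hf

end IsNormalizedCurve

theorem coeff_X_pow_mul_X_sub_one_pow (a s : ℕ) (d : Fin 2 →₀ ℕ) :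
    coeff d (X 0 ^ a * (X 1 - 1) ^ s : MvPolynomial (Fin 2) k) =
      if d 0 = a then (-1) ^ (s - d 1) * (s.choose (d 1) : k) else 0 := by
  have hsum : (X 0 ^ a * (X 1 - 1) ^ s : MvPolynomial (Fin 2) k) =
      ∑ i ∈ Finset.range (s + 1), monomial (Finsupp.single 0 a + Finsupp.single 1 i)
        ((-1) ^ (s - i) * (s.choose i : k)) := by
    rw [sub_eq_add_neg, add_pow, Finset.mul_sum]
    refine Finset.sum_congr rfl fun i _ => ?_
    have hC : ((-1) ^ (s - i) * (s.choose i : MvPolynomial (Fin 2) k)) =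
        C ((-1) ^ (s - i) * (s.choose i : k)) := by simp
    rw [mul_assoc (X 1 ^ i), hC, X_pow_eq_monomial, X_pow_eq_monomial, ← mul_assoc, monomial_mul,
      mul_comm, C_mul_monomial, one_mul, mul_one]
  have heq (i : ℕ) : Finsupp.single 0 a + Finsupp.single 1 i = d ↔ d 0 = a ∧ d 1 = i := by
    simp [Finsupp.ext_iff, Fin.forall_fin_two, eq_comm]
  simp only [hsum, coeff_sum, coeff_monomial, heq]
  by_cases hd : d 0 = a
  · simp only [hd, true_and, if_true, Finset.sum_ite_eq, Finset.mem_range]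
    rw [ite_eq_left_iff]
    intro hs
    rw [Nat.choose_eq_zero_of_lt (by omega), Nat.cast_zero, mul_zero]
  · simp [hd]

theorem IsNormalizedCurve.sub_corner {m a s : ℕ}
    (hf : IsNormalizedCurve (insert ((a : ℝ), (s : ℝ)) Δ) m f) (ha : 0 < a) (hms : m ≤ s)
    (hΔ : ∀ b < s, ((a : ℝ), (b : ℝ)) ∈ Δ) :
    IsNormalizedCurve Δ m (f - C (coeff (Finsupp.single 0 a + Finsupp.single 1 s) f)
      * X 0 ^ a * (X 1 - 1) ^ s) where
  supported d hd := by
    rw [mem_support_iff, coeff_sub, mul_assoc, coeff_C_mul, coeff_X_pow_mul_X_sub_one_pow] at hd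
    by_contra hdΔ
    have hapex : d ≠ Finsupp.single 0 a + Finsupp.single 1 s := by
      rintro rfl
      simp at hd
    have hne : ¬ (d 0 = a ∧ d 1 = s) := fun h => hapex <| by
      simpa [Finsupp.ext_iff, Fin.forall_fin_two] using h
    have hdf : coeff d f = 0 := by
      by_contra h
      exact hne (by simpa using (hf.supported d (mem_support_iff.mpr h)).resolve_right hdΔ)
    rw [hdf, zero_sub, neg_ne_zero, mul_ite, mul_zero, ite_ne_right_iff] at hd
    have hle : d 1 ≤ s := by
      by_contra! h
      simp [Nat.choose_eq_zero_of_lt h] at hd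
    exact hdΔ (hd.1 ▸ hΔ (d 1) (lt_of_le_of_ne hle fun h => hne ⟨hd.1, h⟩))
  vanishes := by
    have hs : VanishesToOrder s ((X 1 - 1) ^ s : MvPolynomial (Fin 2) k) := by
      simpa only [mul_one] using (vanishesToOrder_X_sub_one 1).pow s
    exact hf.vanishes.sub ((hs.mono hms).mul_left _)
  constantTerm := by
    rw [coeff_sub, mul_assoc, coeff_C_mul, coeff_X_pow_mul_X_sub_one_pow,
      if_neg (by simpa using ha.ne), mul_zero, sub_zero, hf.constantTerm]

theorem eq_apex_or_slope_le {m₁ s₁ m₂ s₂ p q a b a' b' : ℕ} (hm₁ : 0 < m₁) (hm₂ : 0 < m₂)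
    (hp : 0 < p) (h₁ : p * s₁ = q * m₁ + 1) (h₂ : p * s₂ + 1 = q * m₂)
    (ha : a ≤ m₁) (hb : m₁ * b ≤ s₁ * a) (hb' : m₂ * b' ≤ s₂ * a') :
    ((a = m₁ ∧ b = s₁) ∧ a' = 0 ∧ b' = 0) ∨ p * (b + b') ≤ q * (a + a') := by
  rw [or_iff_not_imp_right, not_le]
  intro hlt
  have hab : m₁ * (p * b) ≤ (q * m₁ + 1) * a := by rw [← h₁]; nlinarith
  have hab' : m₂ * (p * b') + a' ≤ q * m₂ * a' := by rw [← h₂]; nlinarith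
  have hle : p * b ≤ q * a + 1 := by
    by_contra! h
    nlinarith
  have hle' : p * b' ≤ q * a' := by
    by_contra! h
    nlinarith
  have hslope' : p * b' = q * a' := by linarith
  have hslope : p * b = q * a + 1 := by linarith
  have ha' : a' = 0 := by
    rw [hslope'] at hab'
    nlinarith
  have ham : a = m₁ := by
    rw [hslope] at hab
    nlinarith
  subst ham ha'
  exact ⟨⟨rfl, Nat.eq_of_mul_eq_mul_left hp (hslope.trans h₁.symm)⟩, rfl, by
    simpa [hp.ne'] using hslope'⟩

/-- The numerical situation in which the lattice points of the Minkowski sum of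
`triangle K m₁ (m₁ + m₂)` and `triangle K m₂ s₂` are those of `triangle K (m₁ + m₂) (K * m₂)`,
whose left side has slope `q / p`, and the apex `(m₁, m₁ + m₂)` of the first summand. -/
structure IsCornerPair (K m₁ m₂ s₂ p q : ℕ) : Prop where
  pos_left : 0 < m₁
  pos_right : 0 < m₂
  add_le : m₁ + m₂ ≤ K * m₁
  add_add_eq : m₁ + m₂ + s₂ = K * m₂
  mul_add_eq : p * (m₁ + m₂) = q * m₁ + 1
  mul_add_one_eq : p * s₂ + 1 = q * m₂

namespace IsCornerPair

variable {K m₁ m₂ s₂ p q : ℕ}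

theorem mul_slope (h : IsCornerPair K m₁ m₂ s₂ p q) : p * (K * m₂) = q * (m₁ + m₂) := by
  rw [← h.add_add_eq]
  linarith [h.mul_add_eq, h.mul_add_one_eq]

theorem pos_denom (h : IsCornerPair K m₁ m₂ s₂ p q) : 0 < p :=
  Nat.pos_of_mul_pos_right (h.mul_add_eq.symm ▸ Nat.succ_pos _ : 0 < p * (m₁ + m₂))

theorem mem_triangle_iff (h : IsCornerPair K m₁ m₂ s₂ p q) {a b : ℕ} :
    ((a : ℝ), (b : ℝ)) ∈ triangle K (m₁ + m₂) (K * m₂) ↔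
      a ≤ m₁ + m₂ ∧ p * b ≤ q * a ∧ K * a ≤ K * m₁ + b := by
  have hm : 0 < m₁ + m₂ := Nat.add_pos_left h.pos_left _
  have hK : 0 < K := Nat.pos_of_mul_pos_right (hm.trans_le h.add_le)
  have hmem := natCast_mem_triangle_iff (a := a) (b := b) hK hm
    (show K * m₂ + K * m₁ = K * (m₁ + m₂) by ring)
  push_cast at hmem
  rw [hmem]
  refine and_congr_right' (and_congr_left' ?_)
  calc (m₁ + m₂) * b ≤ K * m₂ * a ↔ p * ((m₁ + m₂) * b) ≤ p * (K * m₂ * a) :=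
        (Nat.mul_le_mul_left_iff h.pos_denom).symm
    _ ↔ (m₁ + m₂) * (p * b) ≤ (m₁ + m₂) * (q * a) := by
        rw [← mul_assoc p (K * m₂), h.mul_slope, mul_left_comm p, mul_comm q, mul_assoc]
    _ ↔ p * b ≤ q * a := Nat.mul_le_mul_left_iff hm

theorem eq_apex_or_add_mem (h : IsCornerPair K m₁ m₂ s₂ p q) {a b a' b' : ℕ}
    (hab : ((a : ℝ), (b : ℝ)) ∈ triangle K m₁ (m₁ + m₂))
    (hab' : ((a' : ℝ), (b' : ℝ)) ∈ triangle K m₂ s₂) :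
    ((a = m₁ ∧ b = m₁ + m₂) ∧ a' = 0 ∧ b' = 0) ∨
      (((a + a' : ℕ) : ℝ), ((b + b' : ℕ) : ℝ)) ∈ triangle K (m₁ + m₂) (K * m₂) := by
  obtain ⟨t, ht⟩ := Nat.exists_eq_add_of_le h.add_le
  have hK : 0 < K := Nat.pos_of_mul_pos_right ((Nat.add_pos_left h.pos_left _).trans_le h.add_le)
  rw [← Nat.cast_add, natCast_mem_triangle_iff hK h.pos_left ht.symm] at hab
  rw [natCast_mem_triangle_iff hK h.pos_right ((add_comm _ _).trans h.add_add_eq)] at hab'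
  refine (eq_apex_or_slope_le h.pos_left h.pos_right h.pos_denom h.mul_add_eq h.mul_add_one_eq
    hab.1 hab.2.1 hab'.2.1).imp_right fun hslope => h.mem_triangle_iff.mpr
      ⟨add_le_add hab.1 hab'.1, hslope, ?_⟩
  rw [mul_add, ht]
  linarith [hab.2.2, hab'.2.2]

theorem apex_notMem (h : IsCornerPair K m₁ m₂ s₂ p q) :
    ((m₁ : ℝ), ((m₁ + m₂ : ℕ) : ℝ)) ∉ triangle K (m₁ + m₂) (K * m₂) := fun hmem =>
  absurd (h.mem_triangle_iff.mp hmem).2.1 (by rw [h.mul_add_eq]; exact Nat.not_succ_le_self _)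

theorem mem_of_lt (h : IsCornerPair K m₁ m₂ s₂ p q) {b : ℕ} (hb : b < m₁ + m₂) :
    ((m₁ : ℝ), (b : ℝ)) ∈ triangle K (m₁ + m₂) (K * m₂) := by
  refine h.mem_triangle_iff.mpr ⟨Nat.le_add_right _ _, ?_, Nat.le_add_right _ _⟩
  have := Nat.mul_lt_mul_of_pos_left hb h.pos_denom
  rw [h.mul_add_eq] at this
  exact Nat.le_of_lt_succ this

theorem supportedIn_mul (h : IsCornerPair K m₁ m₂ s₂ p q)
    (hf : SupportedIn (triangle K m₁ (m₁ + m₂)) f) (hg : SupportedIn (triangle K m₂ s₂) g) :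
    SupportedIn (insert ((m₁ : ℝ), ((m₁ + m₂ : ℕ) : ℝ)) (triangle K (m₁ + m₂) (K * m₂)))
      (f * g) := by
  intro d hd
  obtain ⟨u, hu, v, hv, rfl⟩ := Finset.mem_add.mp (support_mul _ _ hd)
  rcases h.eq_apex_or_add_mem (hf u hu) (hg v hv) with ⟨⟨hu0, hu1⟩, hv0, hv1⟩ | hmem
  · simp [hu0, hu1, hv0, hv1]
  · exact Set.mem_insert_of_mem _ hmem

theorem coeff_apex_mul (h : IsCornerPair K m₁ m₂ s₂ p q)
    (hf : SupportedIn (triangle K m₁ (m₁ + m₂)) f) (hg : SupportedIn (triangle K m₂ s₂) g) :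
    coeff (Finsupp.single 0 m₁ + Finsupp.single 1 (m₁ + m₂)) (f * g) =
      coeff (Finsupp.single 0 m₁ + Finsupp.single 1 (m₁ + m₂)) f * coeff 0 g := by
  rw [coeff_mul]
  refine Finset.sum_eq_single (Finsupp.single 0 m₁ + Finsupp.single 1 (m₁ + m₂), 0) ?_ (by simp)
  rintro ⟨u, v⟩ huv hne
  rw [Finset.HasAntidiagonal.mem_antidiagonal] at huv
  by_contra hprod
  have hu := hf u (mem_support_iff.mpr (left_ne_zero_of_mul hprod))
  have hv := hg v (mem_support_iff.mpr (right_ne_zero_of_mul hprod))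
  have huv0 : u 0 + v 0 = m₁ := by simpa using DFunLike.congr_fun huv 0
  have huv1 : u 1 + v 1 = m₁ + m₂ := by simpa using DFunLike.congr_fun huv 1
  rcases h.eq_apex_or_add_mem hu hv with ⟨-, hv0, hv1⟩ | hmem
  · have hv : v = 0 := by ext i; fin_cases i <;> assumption
    exact hne (Prod.ext (by rw [← huv, hv, add_zero]) hv)
  · rw [huv0, huv1] at hmem
    exact h.apex_notMem hmem

theorem isNormalizedCurve_mul_sub (h : IsCornerPair K m₁ m₂ s₂ p q)
    (hf : IsNormalizedCurve (triangle K m₁ (m₁ + m₂)) m₁ f)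
    (hg : IsNormalizedCurve (triangle K m₂ s₂) m₂ g) :
    IsNormalizedCurve (triangle K (m₁ + m₂) (K * m₂)) (m₁ + m₂)
      (f * g - C (coeff (Finsupp.single 0 m₁ + Finsupp.single 1 (m₁ + m₂)) f)
        * X 0 ^ m₁ * (X 1 - 1) ^ (m₁ + m₂)) := by
  have hfg := hf.mul hg
  have hcorner := IsNormalizedCurve.sub_corner
    ⟨h.supportedIn_mul hf.supported hg.supported, hfg.vanishes, hfg.constantTerm⟩
    h.pos_left le_rfl fun b => h.mem_of_lt
  rwa [h.coeff_apex_mul hf.supported hg.supported, hg.constantTerm, mul_one] at hcorner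

end IsCornerPair

end Curves

namespace IsSolution

variable {K M N : ℕ}

theorem eq_one_of_eq_zero (h : IsSolution K M 0) : M = 1 := by
  simpa [IsSolution] using h

theorem symm (h : IsSolution K M N) : IsSolution K N M := by
  unfold IsSolution at *
  rw [add_comm, h, mul_right_comm]

theorem add_pos (h : IsSolution K M N) : 0 < M + N :=
  Nat.pos_of_ne_zero fun h0 => by simp [IsSolution, h0] at h

theorem add_two_mul_le (h : IsSolution K M N) (hK : 2 ≤ K) (hN : 0 < N) :
    M + 2 * N ≤ K * N := by
  unfold IsSolution at h
  by_contra! hlt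
  obtain rfl | hM := Nat.eq_zero_or_pos M
  · nlinarith
  · nlinarith [Nat.mul_le_mul_right M (Nat.succ_le_iff.mpr hlt)]

/-- The self-intersection number of the curve of `IT(M,N)` is `-1`. -/
theorem isBalanced_int (h : IsSolution K M N) (hK : 0 < K) :
    IsBalanced K 1 (M + N) (K * N) (K * M) where
  add_eq := by ring
  mul_lt := by
    rw [show (M + N) ^ 2 = K * M * N + 1 from h]
    linarith
  le_mul := by
    rw [show (M + N) ^ 2 = K * M * N + 1 from h]
    exact le_of_eq (by ring)

/-- The self-intersection number of the curve of `RT(M,N)` is `-1 / K`. -/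
theorem isBalanced_rat (h : IsSolution K M N) {t c : ℕ} (ht : M + N + t = K * M) (hc : c ≤ K) :
    IsBalanced K c M (M + N) t := by
  have hdefect : (M + N) * t + 1 = K * M ^ 2 := by
    unfold IsSolution at h
    zify at *
    linear_combination (M + N : ℤ) * ht - h
  exact ⟨ht, by omega, by rw [← hdefect, mul_add, mul_one]; exact Nat.add_le_add_left hc _⟩

theorem exists_tau (h : IsSolution K M N) (hK : 2 ≤ K) (hN : 0 < N) :
    ∃ N' : ℕ, tau K (M, N) = ((N : ℤ), (N' : ℤ)) ∧ N + N' + (M + N) = K * N ∧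
      N ^ 2 = M * N' + 1 ∧ IsSolution K N N' := by
  obtain ⟨N', hN'⟩ := Nat.exists_eq_add_of_le (h.add_two_mul_le hK hN)
  have hsq : N ^ 2 = M * N' + 1 := by
    unfold IsSolution at h
    zify at *
    linear_combination h + M * hN'
  refine ⟨N', ?_, by omega, hsq, ?_⟩
  · ext
    · rfl
    · simp only [tau]
      zify at hN'
      linarith
  · unfold IsSolution
    zify at *
    linear_combination hsq - N' * hN'

theorem isCornerPair_rat {N' : ℕ} (h : IsSolution K M N) (hM : 0 < M) (hN : 0 < N)
    (hle : M + N ≤ K * M) (hN' : N + N' + (M + N) = K * N) (hsq : N ^ 2 = M * N' + 1) :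
    IsCornerPair K M N (N + N') (M + N) (K * N) where
  pos_left := hM
  pos_right := hN
  add_le := hle
  add_add_eq := by rw [add_comm, hN']
  mul_add_eq := by rw [← sq, show (M + N) ^ 2 = K * M * N + 1 from h, mul_right_comm]
  mul_add_one_eq := by
    zify at *
    linear_combination N * hN' - hsq

theorem isCornerPair_int {N' : ℕ} (h : IsSolution K N N') (hN : 0 < N)
    (hN' : N + N' + (M + N) = K * N) (hsq : N ^ 2 = M * N' + 1) :
    IsCornerPair K (M + N) (N + N') (K * N') N (N + N') where
  pos_left := Nat.add_pos_right _ hN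
  pos_right := h.add_pos
  add_le := by
    rw [add_comm, hN']
    exact Nat.mul_le_mul_left K (Nat.le_add_left N M)
  add_add_eq := by rw [add_comm (M + N), hN', mul_add]
  mul_add_eq := by
    unfold IsSolution at h
    zify at *
    linear_combination hsq
  mul_add_one_eq := by rw [← sq, show (N + N') ^ 2 = K * N * N' + 1 from h]; ring

end IsSolution

section Xi

variable {k : Type*} [Field k] {K M N : ℕ} {f : MvPolynomial (Fin 2) k}

theorem isXiInt_iff (hK : 0 < K) :
    IsXiInt K (M, N) f ↔ IsNormalizedCurve (triangle K (M + N) (K * N)) (M + N) f := by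
  have hK' : (K : ℝ) ≠ 0 := by exact_mod_cast hK.ne'
  have hIT : IT K (M, N) = triangle K (M + N) (K * N) := by
    simp [IT, triangle, mul_div_cancel_left₀ _ hK']
  rw [IsXiInt, hIT]
  rfl

theorem isXiRat_iff :
    IsXiRat K (M, N) f ↔ IsNormalizedCurve (triangle K M (M + N)) M f := by
  simp only [IsXiRat, RT, triangle, Int.cast_natCast, Int.toNat_natCast]

theorem natCast_mem_RT_zero_neg_one_iff (hK : 2 ≤ K) {a b : ℕ} :
    ((a : ℝ), (b : ℝ)) ∈ RT K (0, -1) ↔ a = 0 ∧ b = 0 := by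
  refine ⟨fun h => ?_, ?_⟩
  · have hsub : RT K (0, -1) ⊆ {P : ℝ × ℝ | P.1 ≤ 1 / K} ∩ {P : ℝ × ℝ | P.2 ≤ 0} := by
      refine convexHull_min ?_ ((convex_halfSpace_le (LinearMap.fst ℝ ℝ ℝ).isLinear _).inter
        (convex_halfSpace_le (LinearMap.snd ℝ ℝ ℝ).isLinear _))
      rintro P (rfl | rfl | rfl) <;> simp [neg_div]
    obtain ⟨ha, hb⟩ := hsub h
    have hK' : (1 : ℝ) / K < 1 := (div_lt_one (by positivity)).mpr (by exact_mod_cast hK)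
    have ha' : a < 1 := by exact_mod_cast lt_of_le_of_lt (show (a : ℝ) ≤ 1 / K from ha) hK'
    exact ⟨Nat.lt_one_iff.mp ha', Nat.le_zero.mp (by exact_mod_cast (show (b : ℝ) ≤ 0 from hb))⟩
  · rintro ⟨rfl, rfl⟩
    exact subset_convexHull _ _ (by simp)

theorem isXiRat_zero_neg_one_iff (hK : 2 ≤ K) : IsXiRat K (0, -1) f ↔ f = 1 := by
  have hsupp : SupportedIn (RT K (0, -1)) f ↔ f.support ⊆ {0} := by
    refine forall₂_congr fun d _ => ?_
    rw [natCast_mem_RT_zero_neg_one_iff hK, Finset.mem_singleton, Finsupp.ext_iff,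
      Fin.forall_fin_two]
    rfl
  constructor
  · rintro ⟨hf, -, hf0⟩
    ext d
    rw [coeff_one]
    split_ifs with hd
    · rw [← hd, hf0]
    · by_contra hne
      exact hd (Finset.mem_singleton.mp (hsupp.mp hf (mem_support_iff.mpr hne))).symm
  · rintro rfl
    exact ⟨hsupp.mpr support_one.subset, fun d hd => absurd hd (Nat.not_lt_zero _), coeff_zero_one⟩

theorem xiRat_zero_neg_one (hK : 2 ≤ K) : xiRat k K (0, -1) = 1 :=
  (isXiRat_zero_neg_one_iff hK).mp
    (Classical.epsilon_spec ⟨1, (isXiRat_zero_neg_one_iff hK).mpr rfl⟩)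

theorem isNormalizedCurve_one_sub_monomial {Δ : Set (ℝ × ℝ)} {d : Fin 2 →₀ ℕ} (hd : d ≠ 0)
    (hzero : ((0 : ℝ), (0 : ℝ)) ∈ Δ) (hΔ : ((d 0 : ℝ), (d 1 : ℝ)) ∈ Δ) :
    IsNormalizedCurve Δ 1 (1 - monomial d 1 : MvPolynomial (Fin 2) k) where
  supported e he := by
    rw [mem_support_iff, coeff_sub, coeff_one, coeff_monomial] at he
    by_cases he0 : 0 = e
    · subst he0
      simpa using hzero
    · obtain rfl : d = e := by
        by_contra hde
        simp [he0, hde] at he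
      exact hΔ
  vanishes e he := by
    obtain rfl : e = 0 := (Finsupp.degree_eq_zero_iff e).mp (Nat.lt_one_iff.mp he)
    rw [map_sub, map_one, aeval_monomial, ← constantCoeff_eq]
    simp [Finsupp.prod]
  constantTerm := by simp [coeff_monomial, hd]

variable [CharZero k]

theorem IsSolution.existsUnique_isXiInt (h : IsSolution K M N) (hK : 0 < K) :
    ∃! f : MvPolynomial (Fin 2) k, IsXiInt K (M, N) f := by
  simpa [isXiInt_iff hK] using
    (h.isBalanced_int hK).existsUnique_isNormalizedCurve (k := k) one_pos

theorem IsSolution.existsUnique_isXiRat (h : IsSolution K M N) (hK : 2 ≤ K) (hM : 0 < M) :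
    ∃! f : MvPolynomial (Fin 2) k, IsXiRat K (M, N) f := by
  obtain ⟨t, ht⟩ := Nat.exists_eq_add_of_le ((add_comm M N).trans_le (by
    have := h.symm.add_two_mul_le hK hM; omega) : M + N ≤ K * M)
  simpa [isXiRat_iff] using
    (h.isBalanced_rat ht.symm (one_le_two.trans hK)).existsUnique_isNormalizedCurve (k := k) one_pos

theorem IsSolution.existsUnique_isXiRat_tau (h : IsSolution K M N) (hK : 2 ≤ K) :
    ∃! f : MvPolynomial (Fin 2) k, IsXiRat K (tau K (M, N)) f := by
  obtain rfl | hN := Nat.eq_zero_or_pos N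
  · obtain rfl := h.eq_one_of_eq_zero
    simp [tau, isXiRat_zero_neg_one_iff hK]
  · obtain ⟨N', htau, -, -, hsol⟩ := h.exists_tau hK hN
    exact htau ▸ hsol.existsUnique_isXiRat hK hN

theorem IsSolution.existsUnique_isXiInt_tau (h : IsSolution K M N) (hK : 2 ≤ K) (hN : 0 < N) :
    ∃! f : MvPolynomial (Fin 2) k, IsXiInt K (tau K (M, N)) f := by
  obtain ⟨N', htau, -, -, hsol⟩ := h.exists_tau hK hN
  exact htau ▸ hsol.existsUnique_isXiInt (by omega)

theorem IsSolution.isXiInt_xiInt (h : IsSolution K M N) (hK : 0 < K) :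
    IsXiInt K (M, N) (xiInt k K (M, N)) :=
  Classical.epsilon_spec (h.existsUnique_isXiInt hK).exists

theorem IsSolution.isXiRat_xiRat (h : IsSolution K M N) (hK : 2 ≤ K) (hM : 0 < M) :
    IsXiRat K (M, N) (xiRat k K (M, N)) :=
  Classical.epsilon_spec (h.existsUnique_isXiRat hK hM).exists

theorem isSolution_one_zero : IsSolution K 1 0 := by
  simp [IsSolution]

variable (k)

theorem xiInt_one_zero (hK : 0 < K) : xiInt k K (1, 0) = 1 - X 0 := by
  refine (isSolution_one_zero.existsUnique_isXiInt hK).unique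
    (isSolution_one_zero.isXiInt_xiInt hK) ?_
  exact isNormalizedCurve_one_sub_monomial (by simp) (subset_convexHull _ _ (by simp))
    (subset_convexHull _ _ (by simp))

theorem xiRat_one_zero (hK : 2 ≤ K) : xiRat k K (1, 0) = 1 - X 0 * X 1 := by
  refine (isSolution_one_zero.existsUnique_isXiRat hK one_pos).unique
    (isSolution_one_zero.isXiRat_xiRat hK one_pos) ?_
  rw [X, X, monomial_mul, one_mul]
  exact isNormalizedCurve_one_sub_monomial (fun h => by simpa using DFunLike.congr_fun h 0)
    (subset_convexHull _ _ (by simp)) (subset_convexHull _ _ (by simp))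

theorem epsRat_one_zero (hK : 2 ≤ K) : epsRat k K 1 0 = -1 := by
  have h0 : (0 : Fin 2 →₀ ℕ) ≠ Finsupp.single 0 1 + Finsupp.single 1 1 :=
    fun h => by simpa using DFunLike.congr_fun h 0
  have h := xiRat_one_zero k hK
  rw [X, X, monomial_mul, one_mul] at h
  simp [epsRat, h, coeff_one, h0]

end Xi

section Relations

variable {k : Type*} [Field k] [CharZero k] {K M N : ℕ}

theorem IsSolution.xiInt_eq (h : IsSolution K M N) (hK : 2 ≤ K) (hM : 0 < M) :
    xiInt k K (M, N) = xiRat k K (M, N) * xiRat k K (tau K (M, N))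
      - C (epsRat k K M N) * X 0 ^ M * (X 1 - 1) ^ (M + N) := by
  have hK0 : 0 < K := two_pos.trans_le hK
  obtain rfl | hN := Nat.eq_zero_or_pos N
  · obtain rfl := h.eq_one_of_eq_zero
    have htau : tau K (1, 0) = (0, -1) := by simp [tau]
    rw [epsRat_one_zero k hK, Nat.cast_one, Nat.cast_zero, htau, xiRat_zero_neg_one hK,
      xiInt_one_zero k hK0, xiRat_one_zero k hK, C_neg, C_1]
    ring
  obtain ⟨N', htau, hN', hsq, hsol⟩ := h.exists_tau hK hN
  have hle : M + N ≤ K * M := by have := h.symm.add_two_mul_le hK hM; omega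
  have hmul := (h.isCornerPair_rat hM hN hle hN' hsq).isNormalizedCurve_mul_sub
    (isXiRat_iff.mp (h.isXiRat_xiRat (k := k) hK hM))
    (by simpa using isXiRat_iff.mp (hsol.isXiRat_xiRat (k := k) hK hN))
  rw [htau]
  exact (h.existsUnique_isXiInt hK0).unique (h.isXiInt_xiInt hK0) ((isXiInt_iff hK0).mpr hmul)

/-- Both sides are normalized curves of the `K`-fold dilation of `RT(τ(M,N))`. -/
theorem IsSolution.xiRat_tau_pow_eq (h : IsSolution K M N) (hK : 2 ≤ K) (hN : 0 < N) :
    xiRat k K (tau K (M, N)) ^ K = xiInt k K (M, N) * xiInt k K (tau K (M, N))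
      - C (epsInt k K M N) * X 0 ^ (M + N) * (X 1 - 1) ^ (K * N) := by
  have hK0 : 0 < K := two_pos.trans_le hK
  obtain ⟨N', htau, hN', hsq, hsol⟩ := h.exists_tau hK hN
  have hsum : M + N + (N + N') = K * N := by rw [add_comm, hN']
  have hsumR : (M + N + (N + N') : ℝ) = K * N := by exact_mod_cast hsum
  have hpow := (isXiRat_iff.mp (hsol.isXiRat_xiRat (k := k) hK hN)).pow (convex_convexHull ℝ _) K
  have hmul := (hsol.isCornerPair_int hN hN' hsq).isNormalizedCurve_mul_sub
    (f := xiInt k K (M, N)) (g := xiInt k K (N, N'))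
    (by simpa [hsumR] using (isXiInt_iff hK0).mp (h.isXiInt_xiInt (k := k) hK0))
    (by simpa using (isXiInt_iff hK0).mp (hsol.isXiInt_xiInt (k := k) hK0))
  rw [smul_triangle] at hpow
  push_cast at hmul
  rw [hsum, hsumR] at hmul
  rw [htau]
  refine ((hsol.isBalanced_rat hN' le_rfl).existsUnique_isNormalizedCurve hK0).unique ?_ ?_
  · simpa using hpow
  · simpa only [epsInt, Nat.cast_add] using hmul

theorem eq_xi_of_relations (hK : 2 ≤ K) {F G : ℤ × ℤ → MvPolynomial (Fin 2) k}
    (hF : F (1, 0) = 1 - X 0) (hG : G (1, 0) = 1 - X 0 * X 1)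
    (hrel : ∀ M N : ℕ, IsSolution K M N → 0 < N → N < M →
      F (M, N) = G (M, N) * G (tau K (M, N))
        - C (epsRat k K M N) * X 0 ^ M * (X 1 - 1) ^ (M + N) ∧
      G (tau K (M, N)) ^ K = F (M, N) * F (tau K (M, N))
        - C (epsInt k K M N) * X 0 ^ (M + N) * (X 1 - 1) ^ (K * N))
    (M N : ℕ) (h : IsSolution K M N) (hlt : N < M) :
    F (M, N) = xiInt k K (M, N) ∧ G (M, N) = xiRat k K (M, N) := by
  have hK0 : 0 < K := two_pos.trans_le hK
  induction N using Nat.strong_induction_on generalizing M with | _ N ih =>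
  obtain rfl | hN := Nat.eq_zero_or_pos N
  · obtain rfl := h.eq_one_of_eq_zero
    exact ⟨hF.trans (xiInt_one_zero k hK0).symm, hG.trans (xiRat_one_zero k hK).symm⟩
  obtain ⟨N', htau, -, hsq, hsol⟩ := h.exists_tau hK hN
  have hdesc : N' < N := by
    by_contra! hge
    nlinarith
  obtain ⟨hFτ, hGτ⟩ := ih N' hdesc N hsol hdesc
  obtain ⟨hFG, hGF⟩ := hrel M N h hN hlt
  have hxiInt := h.xiInt_eq (k := k) hK (hN.trans hlt)
  have hxiRat := h.xiRat_tau_pow_eq (k := k) hK hN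
  rw [htau] at hFG hGF hxiInt hxiRat
  rw [hGτ] at hFG hGF
  rw [hFτ] at hGF
  have hFeq : F (M, N) = xiInt k K (M, N) :=
    mul_right_cancel₀ (hsol.isXiInt_xiInt hK0).ne_zero (sub_left_injective (hGF.symm.trans hxiRat))
  exact ⟨hFeq, mul_right_cancel₀ (hsol.isXiRat_xiRat hK hN).ne_zero
    (sub_left_injective (hFG.symm.trans (hFeq.trans hxiInt)))⟩

end Relations

theorem lemma6p1 (k : Type*) [Field k] [CharZero k] (K : ℕ) (hK : 3 ≤ K) :
    -- the polynomials are well defined and satisfy the two relations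
    (∀ M N : ℕ, IsSolution K M N →
      (0 < M →
        (∃! f : MvPolynomial (Fin 2) k, IsXiInt K (M, N) f) ∧
        (∃! f : MvPolynomial (Fin 2) k, IsXiRat K (M, N) f) ∧
        (∃! f : MvPolynomial (Fin 2) k, IsXiRat K (tau K (M, N)) f) ∧
        xiInt k K (M, N) = xiRat k K (M, N) * xiRat k K (tau K (M, N))
          - C (epsRat k K M N) * X 0 ^ M * (X 1 - 1) ^ (M + N)) ∧
      (0 < N →
        (∃! f : MvPolynomial (Fin 2) k, IsXiInt K (M, N) f) ∧
        (∃! f : MvPolynomial (Fin 2) k, IsXiInt K (tau K (M, N)) f) ∧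
        (∃! f : MvPolynomial (Fin 2) k, IsXiRat K (tau K (M, N)) f) ∧
        xiRat k K (tau K (M, N)) ^ K = xiInt k K (M, N) * xiInt k K (tau K (M, N))
          - C (epsInt k K M N) * X 0 ^ (M + N) * (X 1 - 1) ^ (K * N))) ∧
    -- given the coefficients `ε`, the relations determine all polynomials with `M > N`
    -- inductively from the ones for `(1,0)`
    xiInt k K (1, 0) = 1 - X 0 ∧
    xiRat k K (1, 0) = 1 - X 0 * X 1 ∧
    (∀ F G : ℤ × ℤ → MvPolynomial (Fin 2) k,
      F (1, 0) = 1 - X 0 →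
      G (1, 0) = 1 - X 0 * X 1 →
      (∀ M N : ℕ, IsSolution K M N → 0 < N → N < M →
        F (M, N) = G (M, N) * G (tau K (M, N))
          - C (epsRat k K M N) * X 0 ^ M * (X 1 - 1) ^ (M + N) ∧
        G (tau K (M, N)) ^ K = F (M, N) * F (tau K (M, N))
          - C (epsInt k K M N) * X 0 ^ (M + N) * (X 1 - 1) ^ (K * N)) →
      ∀ M N : ℕ, IsSolution K M N → N < M →
        F (M, N) = xiInt k K (M, N) ∧ G (M, N) = xiRat k K (M, N)) := by
  have hK2 : 2 ≤ K := by omega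
  have hK0 : 0 < K := by omega
  refine ⟨fun M N h => ⟨fun hM => ?_, fun hN => ?_⟩, xiInt_one_zero k hK0, xiRat_one_zero k hK2,
    fun F G hF hG hrel => eq_xi_of_relations hK2 hF hG hrel⟩
  · exact ⟨h.existsUnique_isXiInt hK0, h.existsUnique_isXiRat hK2 hM,
      h.existsUnique_isXiRat_tau hK2, h.xiInt_eq hK2 hM⟩
  · exact ⟨h.existsUnique_isXiInt hK0, h.existsUnique_isXiInt_tau hK2 hN,
      h.existsUnique_isXiRat_tau hK2, h.xiRat_tau_pow_eq hK2 hN⟩
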